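/- Let $D,K\ge 1$, let $\mathbb L=\mathbb Z^D$, let $\mathbf T=(\mathbb R/\mathbb Z)^K$ with Lebesgue probability measure $\lambda$, and let $\tau:\mathbb L\to\mathbf T$ be an injective group homomorphism with dense image. Let $\mathcal A$ be a finite set with the discrete topology, and give $\mathcal A^{\mathbb L}$ the product topology. Let $\mathcal M$ be the set of $\mathcal A$-labelled measurable partitions of $\mathbf T$, that is, families $\mathcal P=\{P_a\}_{a\in\mathcal A}$ of disjoint measurable sets such that $P_*=\bigsqcup_a P_a$ satisfies $\lambda(P_*)=1$. Equip $\mathcal M$ with the (pseudo)metric $d_\triangle(\mathcal P,\mathcal Q)=\sum_{a}\lambda(P_a\triangle Q_a)$, which identifies partitions that agree up to null sets. Call $\mathcal P$ open if every $P_a$ is open and $P_*$ is dense. For $\mathcal P\in\mathcal M$ put $\widetilde{\mathbf T}=\{t:\ t+\tau(\ell)\in P_*\text{ for all }\ell\in\mathbb L\}$, a set of full measure, and let $\mathcal P_\tau:\widetilde{\mathbf T}\to\mathcal A^{\mathbb L}$ send $t$ to its $\mathcal P$-trajectory: $\mathcal P_\tau(t)_\ell=a$ if and only if $t+\tau(\ell)\in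 P_a$. The quasisturmian measure of $\mathcal P$ is the image measure $\Upsilon(\mathcal P)=\mathcal P_\tau(\lambda)$. If $\mathcal P$ is open, the quasisturmian shift generated by $\mathcal P$ is the closure $\mathfrak P$ of $\mathcal P_\tau(\widetilde{\mathbf T})$ in $\mathcal A^{\mathbb L}$. A cellular automaton is a continuous map $\Phi:\mathcal A^{\mathbb L}\to\mathcal A^{\mathbb L}$ commuting with all shifts. It has a local map $\phi:\mathcal A^{B}\to\mathcal A$ with $B\subset\mathbb L$ finite, so that $\Phi(x)_\ell=\phi\big((x_{\ell+b})_{b\in B}\big)$ for all $x$ and $\ell$. It induces a map $\Phi_*:\mathcal M\to\mathcal M$, $\Phi_*(\mathcal P)=\{Q_a\}_{a\in\mathcal A}$, where $$Q_a=\bigcup_{c\in\mathcal A^{B},\ \phi(c)=a}\ \bigcap_{b\in B}\big(P_{c_b}-\tau(b)\big).$$ Up to null sets, $\Phi_*(\mathcal P)$ does not depend on the choice of the local map. **Theorem.** For every cellular automaton $\Phi:\mathcal A^{\mathbb L}\to\mathcal A^{\mathbb L}$ there is a dense $G_\delta$ subset $\mathcal I\subseteq\mathcal M$ with $\Phi_*(\mathcal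 I)\subseteq\mathcal I$ (for every choice of the local map of $\Phi$ in the definition of $\Phi_*$) such that the following holds for every $\mathcal P\in\mathcal I$. (a) Let $\mu=\Upsilon(\mathcal P)$. Then either $\Phi$ is constant $\mu$-almost everywhere, or $\Phi$ is injective $\mu$-almost everywhere, that is, injective on some set whose complement is $\mu$-null. (b) If $\mathcal P$ is open and $\mathfrak P$ is the quasisturmian shift generated by $\mathcal P$, then either $\Phi|_{\mathfrak P}$ is constant or $\Phi|_{\mathfrak P}$ is injective. -/

import Mathlib

open MeasureTheory Set

noncomputable section

namespace Quasisturmian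

/-! ### Configurations and cellular automata -/

/-- The lattice `ℤ^D`. -/
abbrev ZLat (D : ℕ) : Type := Fin D → ℤ

/-- The space `A^(ℤ^D)` of configurations, with the product topology and the product σ-algebra. -/
abbrev Config (D : ℕ) (A : Type*) : Type _ := ZLat D → A

/-- The shift by `v`: `(shift v x)_k = x_(k - v)`. -/
def shift {D : ℕ} {A : Type*} (v : ZLat D) (x : Config D A) : Config D A :=
  fun k => x (k - v)

/-- A cellular automaton: a continuous self-map of `A^(ℤ^D)` commuting with all shifts. -/
structure IsCellularAutomaton {D : ℕ} {A : Type*} [TopologicalSpace A]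
    (Φ : Config D A → Config D A) : Prop where
  continuous : Continuous Φ
  shift_comm : ∀ (v : ZLat D) (x : Config D A), Φ (shift v x) = shift v (Φ x)

/-- `φ : A^B → A`, with `B` a finite set of lattice points, is a local map of `Φ`:
`Φ(x)_ℓ = φ(x restricted to ℓ + B)` for all `x` and `ℓ`. -/
def IsLocalMap {D : ℕ} {A : Type*} (Φ : Config D A → Config D A)
    (B : Finset (ZLat D)) (φ : (B → A) → A) : Prop :=
  ∀ (x : Config D A) (l : ZLat D), Φ x l = φ (fun b => x (l + b))

/-- Curtis, Hedlund, Lyndon: every cellular automaton has a local map (so that statements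
about all local maps of a cellular automaton are never vacuous). -/
theorem IsCellularAutomaton.exists_isLocalMap {D : ℕ} {A : Type*} [Finite A]
    [TopologicalSpace A] [DiscreteTopology A] {Φ : Config D A → Config D A}
    (hΦ : IsCellularAutomaton Φ) :
    ∃ (B : Finset (ZLat D)) (φ : (B → A) → A), IsLocalMap Φ B φ := by
  classical
  have key : ∀ x : Config D A, ∃ F : Finset (ZLat D),
      ∀ y : Config D A, (∀ i ∈ F, y i = x i) → Φ y 0 = Φ x 0 := by
    intro x
    have ho : IsOpen {y : Config D A | Φ y 0 = Φ x 0} :=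
      (isOpen_discrete {Φ x 0}).preimage ((continuous_apply 0).comp hΦ.continuous)
    obtain ⟨F, u, hu, hsub⟩ := isOpen_pi_iff.1 ho x rfl
    refine ⟨F, fun y hy => hsub ?_⟩
    intro i hi
    rw [hy i hi]
    exact (hu i hi).2
  choose F hF using key
  have hnhds : ∀ x : Config D A, {y : Config D A | ∀ i ∈ F x, y i = x i} ∈ nhds x := by
    intro x
    refine IsOpen.mem_nhds ?_ (fun i _ => rfl)
    have : {y : Config D A | ∀ i ∈ F x, y i = x i} = (F x : Set (ZLat D)).pi fun i => {x i} := by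
      ext y; simp
    rw [this]
    exact isOpen_set_pi (F x).finite_toSet fun i _ => isOpen_discrete _
  obtain ⟨t, ht⟩ := finite_cover_nhds hnhds
  have huniv : ∀ x y : Config D A, (∀ i ∈ t.biUnion F, y i = x i) → Φ y 0 = Φ x 0 := by
    intro x y hxy
    have hx : x ∈ ⋃ z ∈ t, {y : Config D A | ∀ i ∈ F z, y i = z i} := by rw [ht]; trivial
    simp only [mem_iUnion, mem_ofPred_eq] at hx
    obtain ⟨z, hz, hxz⟩ := hx
    rw [hF z x hxz]
    refine hF z y fun i hi => ?_
    rw [hxy i (Finset.mem_biUnion.2 ⟨z, hz, hi⟩), hxz i hi]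
  let B : Finset (ZLat D) := insert 0 (t.biUnion F)
  have h0 : (0 : ZLat D) ∈ B := Finset.mem_insert_self _ _
  refine ⟨B, fun c => Φ (fun k => if h : k ∈ B then c ⟨k, h⟩ else c ⟨0, h0⟩) 0, ?_⟩
  intro x l
  have h1 : Φ x l = Φ (shift (-l) x) 0 := by
    rw [hΦ.shift_comm]
    simp [shift]
  rw [h1]
  refine huniv _ _ fun i hi => ?_
  have hiB : i ∈ B := Finset.mem_insert_of_mem hi
  simp [shift, hiB, add_comm]

/-! ### Measurable partitions of the torus -/

instance : IsProbabilityMeasure (volume : Measure UnitAddCircle) :=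
  ⟨UnitAddCircle.measure_univ⟩

instance (K : ℕ) : IsProbabilityMeasure (volume : Measure (UnitAddTorus (Fin K))) :=
  inferInstanceAs (IsProbabilityMeasure (Measure.pi fun _ : Fin K => (volume : Measure UnitAddCircle)))

/-- An `A`-labelled measurable partition of the torus `𝕋^K = (ℝ/ℤ)^K`: disjoint measurable sets
`P_a`, `a ∈ A`, whose union has full Lebesgue measure. -/
structure MPartition (K : ℕ) (A : Type*) where
  cell : A → Set (UnitAddTorus (Fin K))
  measurableSet_cell : ∀ a, MeasurableSet (cell a)
  disjoint_cell : Pairwise fun a b => Disjoint (cell a) (cell b)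
  volume_iUnion_cell : volume (⋃ a, cell a) = 1

namespace MPartition

variable {D K : ℕ} {A : Type*}

/-- The symmetric difference (pseudo)metric
`d(P, Q) = ∑ a, λ(P_a ∆ Q_a)`; it identifies partitions that agree up to null sets. -/
instance [Fintype A] : PseudoMetricSpace (MPartition K A) where
  dist P Q := ∑ a, volume.real (symmDiff (P.cell a) (Q.cell a))
  dist_self P := by simp
  dist_comm P Q := by simp only [symmDiff_comm]
  dist_triangle P Q R := by
    rw [← Finset.sum_add_distrib]
    exact Finset.sum_le_sum fun a _ => measureReal_symmDiff_le _

/-- An open partition: all cells are open, and their union (which has full measure) is dense. -/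
def IsOpenPartition (P : MPartition K A) : Prop :=
  (∀ a, IsOpen (P.cell a)) ∧ Dense (⋃ a, P.cell a)

/-- The set of points all of whose translates by `τ(ℓ)` lie in `P_* = ⋃ a, P_a`. -/
def domain (τ : ZLat D →+ UnitAddTorus (Fin K)) (P : MPartition K A) :
    Set (UnitAddTorus (Fin K)) :=
  {t | ∀ l, t + τ l ∈ ⋃ a, P.cell a}

/-- The `P`-trajectory of a point `t` of the domain: `(traj t)_ℓ` is the label of the cell
that contains `t + τ(ℓ)`. -/
def traj (τ : ZLat D →+ UnitAddTorus (Fin K)) (P : MPartition K A) (t : P.domain τ) :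
    Config D A :=
  fun l => (mem_iUnion.1 (t.2 l)).choose

theorem traj_eq_iff (τ : ZLat D →+ UnitAddTorus (Fin K)) (P : MPartition K A)
    (t : P.domain τ) (l : ZLat D) (a : A) :
    P.traj τ t l = a ↔ (t : UnitAddTorus (Fin K)) + τ l ∈ P.cell a := by
  have h : (t : UnitAddTorus (Fin K)) + τ l ∈ P.cell (P.traj τ t l) :=
    (mem_iUnion.1 (t.2 l)).choose_spec
  refine ⟨fun e => e ▸ h, fun h' => ?_⟩
  by_contra hne
  exact Set.disjoint_left.1 (P.disjoint_cell hne) h h'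

theorem measurable_traj [Finite A] [MeasurableSpace A] [MeasurableSingletonClass A]
    (τ : ZLat D →+ UnitAddTorus (Fin K)) (P : MPartition K A) :
    Measurable (P.traj τ) := by
  refine measurable_pi_lambda _ fun l => measurable_to_countable' fun a => ?_
  have : (fun t : P.domain τ => P.traj τ t l) ⁻¹' {a} =
      (fun t : P.domain τ => (t : UnitAddTorus (Fin K)) + τ l) ⁻¹' P.cell a := by
    ext t
    simp [traj_eq_iff]
  rw [this]
  exact (measurable_subtype_coe.add_const _) (P.measurableSet_cell a)

/-- The quasisturmian measure of `P`: the image of Lebesgue measure (on the domain, which has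
full measure) under the trajectory map. -/
def qsMeasure [MeasurableSpace A] (τ : ZLat D →+ UnitAddTorus (Fin K)) (P : MPartition K A) :
    Measure (Config D A) :=
  ((volume : Measure (UnitAddTorus (Fin K))).comap Subtype.val).map (P.traj τ)

/-- The quasisturmian shift of `P` (used for open `P`): the closure, in the product topology, of
the set of all trajectories. -/
def qsShift [TopologicalSpace A] (τ : ZLat D →+ UnitAddTorus (Fin K)) (P : MPartition K A) :
    Set (Config D A) :=
  closure (range (P.traj τ))

theorem ae_mem_iUnion_cell (P : MPartition K A) [Finite A] :
    ∀ᵐ t : UnitAddTorus (Fin K), t ∈ ⋃ a, P.cell a := by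
  exact (mem_ae_iff_prob_eq_one (MeasurableSet.iUnion P.measurableSet_cell)).2
    P.volume_iUnion_cell

theorem ae_mem_domain [Finite A] (τ : ZLat D →+ UnitAddTorus (Fin K)) (P : MPartition K A) :
    ∀ᵐ t : UnitAddTorus (Fin K), t ∈ P.domain τ := by
  refine ae_all_iff.2 fun l => ?_
  exact (measurePreserving_add_right volume (τ l)).quasiMeasurePreserving.ae P.ae_mem_iUnion_cell

theorem prob_eq_one_domain [Finite A] (τ : ZLat D →+ UnitAddTorus (Fin K))
    (P : MPartition K A) : volume (P.domain τ) = 1 :=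
  (measure_congr (Filter.eventuallyEq_univ.2 (P.ae_mem_domain τ))).trans measure_univ

/-- The partition induced from `P` by a local map `φ : A^B → A`:
`Q_a = ⋃_{c ∈ A^B, φ(c) = a} ⋂_{b ∈ B} (P_{c_b} translated by -τ(b))`. -/
def induced [Finite A] (τ : ZLat D →+ UnitAddTorus (Fin K)) (B : Finset (ZLat D))
    (φ : (B → A) → A) (P : MPartition K A) : MPartition K A where
  cell a := ⋃ (c : B → A) (_ : φ c = a), ⋂ b : B, (fun t => t + τ b) ⁻¹' P.cell (c b)
  measurableSet_cell a := by
    refine MeasurableSet.iUnion fun c => MeasurableSet.iUnion fun _ => MeasurableSet.iInter fun b => ?_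
    exact (measurable_id.add_const _) (P.measurableSet_cell _)
  disjoint_cell := by
    intro a a' hne
    refine Set.disjoint_left.2 fun t h h' => hne ?_
    simp only [mem_iUnion, mem_iInter, mem_preimage] at h h'
    obtain ⟨c, rfl, hc⟩ := h
    obtain ⟨c', rfl, hc'⟩ := h'
    congr 1
    ext b
    by_contra hb
    exact Set.disjoint_left.1 (P.disjoint_cell hb) (hc b) (hc' b)
  volume_iUnion_cell := by
    refine le_antisymm prob_le_one ?_
    rw [← prob_eq_one_domain τ P]
    refine measure_mono fun t ht => ?_
    choose a ha using fun l => mem_iUnion.1 (ht l)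
    simp only [mem_iUnion, mem_iInter, mem_preimage]
    exact ⟨_, fun b => a b, rfl, fun b => ha b⟩

end MPartition

end Quasisturmian

end

open Quasisturmian

noncomputable section

namespace Quasisturmian

open Filter
open scoped ENNReal Topology

namespace MPartition

variable {D K : ℕ} {A : Type*}

/-! ### The pseudometric space of partitions -/

/-! The proof is a Baire category argument in the complete space of partitions. Write `G` for the
map that a fixed local map of `Φ` induces on partitions. The trajectory of a point under `G P` is
`Φ` applied to its trajectory under `P`, so properties of `Φ` on trajectories become properties of
the single partition `G P`.

Call a partition good if it is trivial, or simple and moreover nowhere open or recoverable from its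
image. The dense set consists of the `P` all of whose iterates `G^[n] P` are good; forward
invariance is then automatic. Goodness is a `Gδ` condition and `G` is Lipschitz, so only the density
of each preimage is at stake. Since `G^[n]` is, up to null sets, induced by a local map of `Φ^[n]`,
one statement about an arbitrary local map `φ` suffices. If `φ` is constant, every image is trivial.
Otherwise the image of a generic partition is nowhere open (`dense_setOf_isNowhereOpen_induced`),
because labels can be prescribed on a small ball at small cost. It is also simple
(`exists_induced_mem_simpleAwayFrom`), because a symmetry would copy a ball of constant label to a
place where the partition was not changed and is nowhere open.

Part (a) uses that `G P` is good. If it is trivial, `Φ` is almost everywhere constant. If it is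
simple, then by density of the orbit of `τ` its trajectories determine almost every point
(`IsSimple.ae_injective`), so `Φ` is almost everywhere injective. Part (b) uses that `P` is good. An
open partition is never nowhere open, so it is trivial, and its shift has at most one point, or
recoverable. In the latter case a local left inverse of `Φ`, valid almost everywhere, extends to the
shift by closedness. Density does not use the recoverable partitions; they leave room for nontrivial
open ones. -/

theorem dist_eq_sum [Fintype A] (P Q : MPartition K A) :
    dist P Q = ∑ a, volume.real (symmDiff (P.cell a) (Q.cell a)) := rfl

theorem measureReal_symmDiff_cell_le_dist [Fintype A] (P Q : MPartition K A) (a : A) :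
    volume.real (symmDiff (P.cell a) (Q.cell a)) ≤ dist P Q := by
  rw [dist_eq_sum]
  exact Finset.single_le_sum (f := fun a => volume.real (symmDiff (P.cell a) (Q.cell a)))
    (fun _ _ => measureReal_nonneg) (Finset.mem_univ a)

/-- The set where the labels given by two partitions differ. -/
def diffSet (P Q : MPartition K A) : Set (UnitAddTorus (Fin K)) :=
  ⋃ a, symmDiff (P.cell a) (Q.cell a)

theorem measureReal_diffSet_le_dist [Fintype A] (P Q : MPartition K A) :
    volume.real (P.diffSet Q) ≤ dist P Q :=
  measureReal_iUnion_fintype_le _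

theorem dist_le_card_mul [Fintype A] {P Q : MPartition K A} {W : Set (UnitAddTorus (Fin K))}
    (h : ∀ a, symmDiff (P.cell a) (Q.cell a) ⊆ W) :
    dist P Q ≤ Fintype.card A * volume.real W := by
  rw [dist_eq_sum]
  calc ∑ a, volume.real (symmDiff (P.cell a) (Q.cell a)) ≤ ∑ _a : A, volume.real W :=
        Finset.sum_le_sum fun a _ => measureReal_mono (h a)
    _ = Fintype.card A * volume.real W := by simp

theorem mem_cell_iff_of_notMem_diffSet {P Q : MPartition K A} {t : UnitAddTorus (Fin K)}
    (h : t ∉ P.diffSet Q) (a : A) : t ∈ P.cell a ↔ t ∈ Q.cell a := by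
  have h' : t ∉ symmDiff (P.cell a) (Q.cell a) := fun h' => h (mem_iUnion.2 ⟨a, h'⟩)
  rw [mem_symmDiff] at h'
  tauto

theorem dist_eq_zero_iff [Fintype A] {P Q : MPartition K A} :
    dist P Q = 0 ↔ ∀ a, P.cell a =ᵐ[volume] Q.cell a := by
  rw [dist_eq_sum, Finset.sum_eq_zero_iff_of_nonneg fun _ _ => measureReal_nonneg]
  simp [measureReal_eq_zero_iff, measure_symmDiff_eq_zero_iff]

theorem eq_of_mem_cell {P : MPartition K A} {t : UnitAddTorus (Fin K)} {a b : A}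
    (ha : t ∈ P.cell a) (hb : t ∈ P.cell b) : a = b := by
  by_contra hne
  exact Set.disjoint_left.1 (P.disjoint_cell hne) ha hb

/-! ### Trajectories as a relation -/

/-- `x` is the `P`-trajectory of `t`. -/
def IsTraj (τ : ZLat D →+ UnitAddTorus (Fin K)) (P : MPartition K A)
    (t : UnitAddTorus (Fin K)) (x : Config D A) : Prop :=
  ∀ l, t + τ l ∈ P.cell (x l)

variable {τ : ZLat D →+ UnitAddTorus (Fin K)}

theorem isTraj_traj (P : MPartition K A) (t : P.domain τ) :
    P.IsTraj τ t (P.traj τ t) :=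
  fun l => (P.traj_eq_iff τ t l _).1 rfl

theorem IsTraj.mem_domain {P : MPartition K A} {t : UnitAddTorus (Fin K)} {x : Config D A}
    (h : P.IsTraj τ t x) : t ∈ P.domain τ :=
  fun l => mem_iUnion.2 ⟨_, h l⟩

theorem IsTraj.eq {P : MPartition K A} {t : UnitAddTorus (Fin K)} {x y : Config D A}
    (hx : P.IsTraj τ t x) (hy : P.IsTraj τ t y) : x = y :=
  funext fun l => eq_of_mem_cell (hx l) (hy l)

theorem ae_exists_isTraj [Finite A] (τ : ZLat D →+ UnitAddTorus (Fin K)) (P : MPartition K A) :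
    ∀ᵐ t, ∃ x : Config D A, P.IsTraj τ t x := by
  filter_upwards [P.ae_mem_domain τ] with t ht
  exact ⟨P.traj τ ⟨t, ht⟩, P.isTraj_traj ⟨t, ht⟩⟩

theorem mem_cell_induced [Finite A] {B : Finset (ZLat D)} {φ : (B → A) → A}
    {P : MPartition K A} {a : A} {t : UnitAddTorus (Fin K)} :
    t ∈ (induced τ B φ P).cell a ↔ ∃ c : B → A, φ c = a ∧ ∀ b : B, t + τ b ∈ P.cell (c b) := by
  simp [induced]

/-- This is the bridge between `Φ` and partitions. As the right-hand side does not involve `φ`, it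
also shows that different local maps, and local maps of iterates, give the same partitions up to
null sets. -/
theorem IsTraj.induced [Finite A] {Φ : Config D A → Config D A} {B : Finset (ZLat D)}
    {φ : (B → A) → A} (hφ : IsLocalMap Φ B φ) {P : MPartition K A}
    {t : UnitAddTorus (Fin K)} {x : Config D A} (h : P.IsTraj τ t x) :
    (induced τ B φ P).IsTraj τ t (Φ x) := by
  intro l
  rw [mem_cell_induced]
  refine ⟨fun b => x (l + b), (hφ x l).symm, fun b => ?_⟩
  have := h (l + b)
  rwa [map_add, ← add_assoc] at this

theorem IsTraj.iterate_induced [Finite A] {Φ : Config D A → Config D A} {B : Finset (ZLat D)}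
    {φ : (B → A) → A} (hφ : IsLocalMap Φ B φ) {P : MPartition K A}
    {t : UnitAddTorus (Fin K)} {x : Config D A} (h : P.IsTraj τ t x) (n : ℕ) :
    ((MPartition.induced τ B φ)^[n] P).IsTraj τ t (Φ^[n] x) := by
  induction n with
  | zero => exact h
  | succ n ih =>
    rw [Function.iterate_succ_apply', Function.iterate_succ_apply']
    exact ih.induced hφ

/-- Two partitions with the same trajectories almost everywhere are identified by the
pseudometric. -/
theorem dist_eq_zero_of_ae_isTraj [Fintype A] {P Q : MPartition K A}
    (h : ∀ᵐ t, ∃ x : Config D A, P.IsTraj τ t x ∧ Q.IsTraj τ t x) : dist P Q = 0 := by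
  refine dist_eq_zero_iff.2 fun a => ?_
  filter_upwards [h] with t ⟨x, hP, hQ⟩
  have h1 := hP 0
  have h2 := hQ 0
  rw [map_zero, add_zero] at h1 h2
  refine propext ⟨fun ha => ?_, fun ha => ?_⟩
  · rw [eq_of_mem_cell ha h1]; exact h2
  · rw [eq_of_mem_cell ha h2]; exact h1

/-! ### Continuity of the induced map -/

/-- The induced label at `t` depends only on the labels at the points `t + τ b`. Hence it can change
only on `B.card` translates of the set where `P` and `Q` differ, and each of the cells contributes
at most the measure of their union. -/
theorem dist_induced_le [Fintype A] (τ : ZLat D →+ UnitAddTorus (Fin K)) (B : Finset (ZLat D))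
    (φ : (B → A) → A) (P Q : MPartition K A) :
    dist (induced τ B φ P) (induced τ B φ Q) ≤ (Fintype.card A * B.card) * dist P Q := by
  have key : ∀ (P Q : MPartition K A) (a : A), ∀ t ∈ (induced τ B φ P).cell a,
      t ∉ ⋃ b ∈ B, (fun t => t + τ b) ⁻¹' P.diffSet Q → t ∈ (induced τ B φ Q).cell a := by
    intro P Q a t ht hW
    simp only [mem_iUnion, mem_preimage, not_exists] at hW
    obtain ⟨c, hc, h⟩ := mem_cell_induced.1 ht
    exact mem_cell_induced.2 ⟨c, hc, fun b =>
      (mem_cell_iff_of_notMem_diffSet (hW b b.2) _).1 (h b)⟩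
  have hcomm : P.diffSet Q = Q.diffSet P := by simp only [diffSet, symmDiff_comm]
  have hsub : ∀ a, symmDiff ((induced τ B φ P).cell a) ((induced τ B φ Q).cell a) ⊆
      ⋃ b ∈ B, (fun t => t + τ b) ⁻¹' P.diffSet Q := by
    rintro a t (⟨h1, h2⟩ | ⟨h1, h2⟩)
    · by_contra hW
      exact h2 (key P Q a t h1 hW)
    · by_contra hW
      rw [hcomm] at hW
      exact h2 (key Q P a t h1 hW)
  have hmeas : MeasurableSet (P.diffSet Q) := by
    exact MeasurableSet.iUnion fun a =>
      (P.measurableSet_cell a).symmDiff (Q.measurableSet_cell a)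
  refine (dist_le_card_mul hsub).trans ?_
  rw [mul_assoc]
  gcongr
  refine (measureReal_biUnion_finset_le _ _).trans ?_
  calc ∑ b ∈ B, volume.real ((fun t => t + τ b) ⁻¹' P.diffSet Q)
      = ∑ _b ∈ B, volume.real (P.diffSet Q) := Finset.sum_congr rfl fun b _ => by
        rw [measureReal_def, measureReal_def,
          (measurePreserving_add_right volume (τ b)).measure_preimage hmeas.nullMeasurableSet]
    _ = B.card * volume.real (P.diffSet Q) := by simp
    _ ≤ B.card * dist P Q := by
        gcongr
        exact measureReal_diffSet_le_dist P Q

theorem continuous_induced [Fintype A] (τ : ZLat D →+ UnitAddTorus (Fin K))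
    (B : Finset (ZLat D)) (φ : (B → A) → A) :
    Continuous (induced τ B φ : MPartition K A → MPartition K A) :=
  (LipschitzWith.of_dist_le_mul (K := Fintype.card A * B.card) fun P Q => by
    simpa using dist_induced_le τ B φ P Q).continuous

/-! ### Completeness -/

/-- Partitions that converge fast enough have a limit: the cells are the lower limits. -/
theorem exists_tendsto_of_dist_lt [Fintype A] {u : ℕ → MPartition K A}
    (hu : ∀ n, dist (u n) (u (n + 1)) ≤ (1 / 2) ^ n) : ∃ P, Tendsto u atTop (𝓝 P) := by
  classical
  let W : ℕ → Set (UnitAddTorus (Fin K)) := fun n => (u n).diffSet (u (n + 1))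
  have hWr : ∀ n, volume.real (W n) ≤ (1 / 2) ^ n := fun n =>
    (measureReal_diffSet_le_dist _ _).trans (hu n)
  have hW : ∀ n, volume (W n) ≤ ENNReal.ofReal ((1 / 2) ^ n) := fun n => by
    rw [← ofReal_measureReal]
    exact ENNReal.ofReal_le_ofReal (hWr n)
  have hsumR : Summable fun n : ℕ => ((1 : ℝ) / 2) ^ n := summable_geometric_two
  have hsum : ∑' n, volume (W n) ≠ ∞ := by
    refine ne_top_of_le_ne_top ?_ (ENNReal.tsum_le_tsum hW)
    rw [← ENNReal.ofReal_tsum_of_nonneg (fun n => by positivity) hsumR]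
    exact ENNReal.ofReal_ne_top
  -- By summability and Borel–Cantelli almost every point lies in only finitely many `W n`; past the
  -- last of them its label no longer changes.
  have hstab : ∀ (t : UnitAddTorus (Fin K)) (N : ℕ), (∀ n ≥ N, t ∉ W n) →
      ∀ n ≥ N, ∀ a, t ∈ (u n).cell a ↔ t ∈ (u N).cell a := by
    intro t N h n hn
    induction n, hn using Nat.le_induction with
    | base => exact fun a => Iff.rfl
    | succ n hn ih =>
      intro a
      rw [← ih a]
      exact (mem_cell_iff_of_notMem_diffSet (h n hn) a).symm
  let P : MPartition K A :=
    { cell := fun a => ⋃ N, ⋂ n ≥ N, (u n).cell a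
      measurableSet_cell := fun a => MeasurableSet.iUnion fun N => MeasurableSet.iInter fun n =>
        MeasurableSet.iInter fun _ => (u n).measurableSet_cell a
      disjoint_cell := by
        intro a b hab
        refine Set.disjoint_left.2 fun t h h' => ?_
        simp only [mem_iUnion, mem_iInter] at h h'
        obtain ⟨N, hN⟩ := h
        obtain ⟨M, hM⟩ := h'
        exact hab (eq_of_mem_cell (hN (max N M) (le_max_left _ _)) (hM (max N M) (le_max_right _ _)))
      volume_iUnion_cell := by
        refine (prob_compl_eq_zero_iff ?_).1 ?_
        · exact MeasurableSet.iUnion fun a => MeasurableSet.iUnion fun N =>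
            MeasurableSet.iInter fun n => MeasurableSet.iInter fun _ => (u n).measurableSet_cell a
        · suffices h : ∀ᵐ t, t ∈ ⋃ a, ⋃ N, ⋂ n ≥ N, (u n).cell a from mem_ae_iff.1 h
          filter_upwards [ae_eventually_notMem hsum, ae_all_iff.2 fun n => (u n).ae_mem_iUnion_cell]
            with t ht hdom
          obtain ⟨N, hN⟩ := eventually_atTop.1 ht
          obtain ⟨a, ha⟩ := mem_iUnion.1 (hdom N)
          simp only [mem_iUnion, mem_iInter]
          exact ⟨a, N, fun n hn => (hstab t N hN n hn a).2 ha⟩ }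
  refine ⟨P, ?_⟩
  have hPcell : ∀ (t : UnitAddTorus (Fin K)) (N : ℕ), (∀ n ≥ N, t ∉ W n) →
      ∀ a, t ∈ P.cell a ↔ t ∈ (u N).cell a := by
    intro t N h a
    constructor
    · intro ht
      obtain ⟨M, hM⟩ := mem_iUnion.1 ht
      simp only [mem_iInter] at hM
      exact (hstab t N h (max M N) (le_max_right _ _) a).1 (hM _ (le_max_left _ _))
    · intro ht
      refine mem_iUnion.2 ⟨N, ?_⟩
      simp only [mem_iInter]
      exact fun n hn => (hstab t N h n hn a).2 ht
  have hdist : ∀ N, dist (u N) P ≤ Fintype.card A * (volume (⋃ n, W (N + n))).toReal := by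
    intro N
    refine dist_le_card_mul fun a t ht => ?_
    by_contra hW'
    have h : ∀ n ≥ N, t ∉ W n := fun n hn hmem => hW' (mem_iUnion.2 ⟨n - N, by
      rwa [Nat.add_sub_cancel' hn]⟩)
    have := hPcell t N h a
    rw [mem_symmDiff] at ht
    tauto
  have hbound : ∀ N, (volume (⋃ n, W (N + n))).toReal ≤ 2 * (1 / 2) ^ N := by
    intro N
    refine ENNReal.toReal_le_of_le_ofReal (by positivity) ?_
    refine (measure_iUnion_le _).trans ((ENNReal.tsum_le_tsum fun n => hW (N + n)).trans ?_)
    have hs : Summable fun n : ℕ => ((1 : ℝ) / 2) ^ (N + n) := by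
      simp only [pow_add]; exact hsumR.mul_left _
    rw [← ENNReal.ofReal_tsum_of_nonneg (fun n => by positivity) hs]
    refine ENNReal.ofReal_le_ofReal (le_of_eq ?_)
    simp only [pow_add]
    rw [tsum_mul_left, tsum_geometric_two, mul_comm]
  rw [tendsto_iff_dist_tendsto_zero]
  refine squeeze_zero (fun _ => dist_nonneg) (fun N => (hdist N).trans
    (mul_le_mul_of_nonneg_left (hbound N) (Nat.cast_nonneg _))) ?_
  have : Tendsto (fun N : ℕ => ((1 : ℝ) / 2) ^ N) atTop (𝓝 0) :=
    tendsto_pow_atTop_nhds_zero_of_lt_one (by norm_num) (by norm_num)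
  simpa using (this.const_mul 2).const_mul (Fintype.card A : ℝ)

/-- Completeness makes the Baire category theorem available in the density arguments. -/
instance [Fintype A] : CompleteSpace (MPartition K A) :=
  Metric.complete_of_convergent_controlled_sequences (fun n => (1 / 2) ^ n) (fun n => by positivity)
    fun u hu => exists_tendsto_of_dist_lt fun n => (hu n n (n + 1) le_rfl n.le_succ).le

end MPartition

namespace MPartition

variable {D K : ℕ} {A : Type*}

/-! ### Trivial, simple, nowhere open and recoverable partitions -/

/-- The partition `P` translated by `-s`. -/
def translate [Finite A] (s : UnitAddTorus (Fin K)) (P : MPartition K A) : MPartition K A where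
  cell a := (fun t => t + s) ⁻¹' P.cell a
  measurableSet_cell a := (measurable_id.add_const _) (P.measurableSet_cell a)
  disjoint_cell a b hab := (P.disjoint_cell hab).preimage _
  volume_iUnion_cell := by
    rw [← preimage_iUnion, (measurePreserving_add_right volume s).measure_preimage
      (MeasurableSet.iUnion P.measurableSet_cell).nullMeasurableSet, P.volume_iUnion_cell]

/-- One cell has full measure. -/
def IsTrivial (P : MPartition K A) : Prop :=
  ∃ a, volume (P.cell a)ᶜ = 0

/-- No nonzero translation of the torus preserves all cells up to null sets. -/
def IsSimple [Fintype A] (P : MPartition K A) : Prop :=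
  ∀ s, dist (P.translate s) P = 0 → s = 0

/-- No nonempty open set is contained in a single cell up to a null set. -/
def IsNowhereOpen (P : MPartition K A) : Prop :=
  ∀ U : Set (UnitAddTorus (Fin K)), IsOpen U → U.Nonempty → ∀ a, volume (U \ P.cell a) ≠ 0

/-- `P` can be recovered, up to null sets, from the partition that the local map `φ` induces,
by a local map with window `W`. -/
def IsRecoverable [Fintype A] (τ : ZLat D →+ UnitAddTorus (Fin K)) (B : Finset (ZLat D))
    (φ : (B → A) → A) (W : Finset (ZLat D)) (P : MPartition K A) : Prop :=
  ∃ ψ : (W → A) → A, dist (induced τ W ψ (induced τ B φ P)) P = 0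

/-- The property whose persistence along the orbit of `P` under the automaton defines the dense
`Gδ` set. Simplicity alone does not suffice: the automaton may merge two labels whose cells, in
a simple open partition, have a common boundary point; then it is injective almost everywhere
but neither constant nor injective on the shift. Generic partitions are nowhere open, and a
simple partition that is not is admitted if it can be recovered from its image. -/
def IsGood [Fintype A] (τ : ZLat D →+ UnitAddTorus (Fin K)) (B : Finset (ZLat D))
    (φ : (B → A) → A) (W : Finset (ZLat D)) (P : MPartition K A) : Prop :=
  P.IsTrivial ∨ P.IsSimple ∧ (P.IsNowhereOpen ∨ P.IsRecoverable τ B φ W)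

/-- The function is 1-Lipschitz: replacing `Q` by `P` enlarges `E \ Q.cell a` at most by the
symmetric difference of the two cells. Triviality thereby becomes a closed condition, and nowhere
openness a countable intersection of open ones. -/
theorem continuous_measureReal_sdiff_cell [Fintype A] (E : Set (UnitAddTorus (Fin K))) (a : A) :
    Continuous fun P : MPartition K A => volume.real (E \ P.cell a) := by
  have key : ∀ P Q : MPartition K A,
      volume.real (E \ P.cell a) ≤ volume.real (E \ Q.cell a) + dist P Q := by
    intro P Q
    calc volume.real (E \ P.cell a)
        ≤ volume.real ((E \ Q.cell a) ∪ symmDiff (P.cell a) (Q.cell a)) := by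
          refine measureReal_mono fun t ht => ?_
          by_cases h : t ∈ Q.cell a
          · exact Or.inr (Or.inr ⟨h, ht.2⟩)
          · exact Or.inl ⟨ht.1, h⟩
      _ ≤ volume.real (E \ Q.cell a) + volume.real (symmDiff (P.cell a) (Q.cell a)) :=
          measureReal_union_le _ _
      _ ≤ _ := by gcongr; exact measureReal_symmDiff_cell_le_dist P Q a
  refine (LipschitzWith.of_le_add_mul 1 fun P Q => ?_).continuous
  simpa using key P Q

theorem isClosed_setOf_isTrivial [Fintype A] :
    IsClosed {P : MPartition K A | P.IsTrivial} := by
  have : {P : MPartition K A | P.IsTrivial} =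
      ⋃ a, {P : MPartition K A | volume.real (univ \ P.cell a) = 0} := by
    ext P
    simp [IsTrivial, measureReal_eq_zero_iff, compl_eq_univ_sdiff]
  rw [this]
  exact isClosed_iUnion_of_finite fun a =>
    isClosed_eq (continuous_measureReal_sdiff_cell univ a) continuous_const

theorem setOf_isNowhereOpen_eq (K : ℕ) (A : Type*) [Finite A] :
    {P : MPartition K A | P.IsNowhereOpen} =
      ⋂ U : TopologicalSpace.countableBasis (UnitAddTorus (Fin K)), ⋂ a,
        {P : MPartition K A | volume.real ((U : Set _) \ P.cell a) ≠ 0} := by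
  have hbas := TopologicalSpace.isBasis_countableBasis (UnitAddTorus (Fin K))
  ext P
  simp only [mem_iInter, mem_ofPred_eq, ne_eq, measureReal_eq_zero_iff (measure_ne_top _ _)]
  constructor
  · intro h U a
    exact h U (hbas.isOpen U.2) (TopologicalSpace.nonempty_of_mem_countableBasis U.2) a
  · intro h U hU hne a h0
    obtain ⟨x, hx⟩ := hne
    obtain ⟨V, hV, hxV, hVU⟩ := hbas.exists_subset_of_mem_open hx hU
    exact h ⟨V, hV⟩ a (measure_mono_null (sdiff_subset_sdiff_left hVU) h0)

theorem isGδ_setOf_isNowhereOpen [Fintype A] :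
    IsGδ {P : MPartition K A | P.IsNowhereOpen} := by
  have := (TopologicalSpace.countable_countableBasis (UnitAddTorus (Fin K))).to_subtype
  rw [setOf_isNowhereOpen_eq]
  exact IsGδ.iInter fun U => IsGδ.iInter fun a =>
    (isOpen_ne_fun (continuous_measureReal_sdiff_cell _ a) continuous_const).isGδ

theorem isClosed_setOf_isRecoverable [Fintype A] (τ : ZLat D →+ UnitAddTorus (Fin K))
    (B : Finset (ZLat D)) (φ : (B → A) → A) (W : Finset (ZLat D)) :
    IsClosed {P : MPartition K A | P.IsRecoverable τ B φ W} := by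
  have : {P : MPartition K A | P.IsRecoverable τ B φ W} =
      ⋃ ψ : (W → A) → A, {P | dist (induced τ W ψ (induced τ B φ P)) P = 0} := by
    ext P
    simp [IsRecoverable]
  rw [this]
  exact isClosed_iUnion_of_finite fun ψ => isClosed_eq
    (((continuous_induced τ W ψ).comp (continuous_induced τ B φ)).dist continuous_id)
    continuous_const

/-! ### Translations and symmetries of partitions -/

theorem dist_translate_translate [Fintype A] (s : UnitAddTorus (Fin K)) (P Q : MPartition K A) :
    dist (P.translate s) (Q.translate s) = dist P Q := by
  simp only [dist_eq_sum, translate]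
  refine Finset.sum_congr rfl fun a _ => ?_
  rw [← preimage_symmDiff, measureReal_def, measureReal_def,
    (measurePreserving_add_right volume s).measure_preimage
      ((P.measurableSet_cell a).symmDiff (Q.measurableSet_cell a)).nullMeasurableSet]

theorem continuous_translate [Fintype A] (P : MPartition K A) :
    Continuous fun s => P.translate s := by
  refine continuous_iff_continuousAt.2 fun s₀ => ?_
  rw [ContinuousAt, tendsto_iff_dist_tendsto_zero]
  simp only [dist_eq_sum]
  rw [← Finset.sum_const_zero (s := (Finset.univ : Finset A))]
  refine tendsto_finsetSum _ fun a _ => ?_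
  let f : UnitAddTorus (Fin K) → C(UnitAddTorus (Fin K), UnitAddTorus (Fin K)) :=
    fun s => ⟨fun t => t + s, by fun_prop⟩
  have hf : Continuous f := ContinuousMap.continuous_of_continuous_uncurry _ (by
    change Continuous fun p : UnitAddTorus (Fin K) × UnitAddTorus (Fin K) => p.2 + p.1
    fun_prop)
  have h := tendsto_measure_symmDiff_preimage_nhds_zero (μ := volume) (ν := volume)
    (hf.tendsto s₀) (Eventually.of_forall fun s => measurePreserving_add_right volume s)
    (measurePreserving_add_right volume s₀) (P.measurableSet_cell a).nullMeasurableSet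
    (measure_ne_top _ _)
  have h' := (ENNReal.tendsto_toReal ENNReal.zero_ne_top).comp h
  exact h'

theorem continuous_dist_translate_self [Fintype A] :
    Continuous fun p : MPartition K A × UnitAddTorus (Fin K) => dist (p.1.translate p.2) p.1 := by
  refine Continuous.dist ?_ continuous_fst
  refine continuous_prod_of_continuous_lipschitzWith _ 1 (fun P => P.continuous_translate)
    fun s => LipschitzWith.of_dist_le_mul fun P Q => ?_
  simp [dist_translate_translate]

/-- The partitions without symmetries of norm at least `ε`. -/
def simpleAwayFrom (K : ℕ) (A : Type*) [Fintype A] (ε : ℝ) : Set (MPartition K A) :=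
  {P | ∀ s, ε ≤ ‖s‖ → dist (P.translate s) P ≠ 0}

/-- The complement is the projection, along the compact torus, of a closed set of pairs (partition,
symmetry). The bound `ε` keeps the symmetries away from the trivial one. -/
theorem isOpen_simpleAwayFrom [Fintype A] (ε : ℝ) : IsOpen (simpleAwayFrom K A ε) := by
  rw [← isClosed_compl_iff]
  have : (simpleAwayFrom K A ε)ᶜ = Prod.fst ''
      {p : MPartition K A × UnitAddTorus (Fin K) | ε ≤ ‖p.2‖ ∧ dist (p.1.translate p.2) p.1 = 0} := by
    ext P
    simp [simpleAwayFrom]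
  rw [this]
  have h1 : IsClosed {p : MPartition K A × UnitAddTorus (Fin K) | ε ≤ ‖p.2‖} :=
    isClosed_le continuous_const continuous_snd.norm
  exact isClosedMap_fst_of_compactSpace _
    (h1.inter (isClosed_eq continuous_dist_translate_self continuous_const))

theorem setOf_isSimple_eq [Fintype A] :
    {P : MPartition K A | P.IsSimple} = ⋂ k : ℕ, simpleAwayFrom K A (1 / (k + 1)) := by
  ext P
  simp only [mem_iInter, simpleAwayFrom, mem_ofPred_eq, IsSimple]
  constructor
  · intro h k s hs h0
    rw [h s h0, norm_zero] at hs
    exact absurd hs (not_le.2 Nat.one_div_pos_of_nat)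
  · intro h s h0
    by_contra hs
    obtain ⟨k, hk⟩ := exists_nat_one_div_lt (norm_pos_iff.2 hs)
    exact h k s hk.le h0

theorem isGδ_setOf_isSimple [Fintype A] : IsGδ {P : MPartition K A | P.IsSimple} := by
  rw [setOf_isSimple_eq]
  exact IsGδ.iInter fun k => (isOpen_simpleAwayFrom _).isGδ

theorem isGδ_setOf_isGood [Fintype A] (τ : ZLat D →+ UnitAddTorus (Fin K))
    (B : Finset (ZLat D)) (φ : (B → A) → A) (W : Finset (ZLat D)) :
    IsGδ {P : MPartition K A | P.IsGood τ B φ W} :=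
  isClosed_setOf_isTrivial.isGδ.union (isGδ_setOf_isSimple.inter
    (isGδ_setOf_isNowhereOpen.union (isClosed_setOf_isRecoverable τ B φ W).isGδ))

end MPartition

/-- A `Gδ` set is saturated under topological indistinguishability. -/
theorem mem_of_isGδ_of_dist_eq_zero {X : Type*} [PseudoMetricSpace X] {s : Set X} (hs : IsGδ s)
    {x y : X} (hxy : dist x y = 0) (hx : x ∈ s) : y ∈ s := by
  obtain ⟨S, hS, -, rfl⟩ := hs
  exact fun u hu => ((Metric.inseparable_iff.2 hxy).mem_open_iff (hS u hu)).1 (hx u hu)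

namespace MPartition

variable {D K : ℕ} {A : Type*}

/-! ### Prescribing labels near a finite piece of an orbit -/

theorem eventually_mul_lt (C : ℝ) {δ : ℝ} (hδ : 0 < δ) : ∀ᶠ r : ℝ in 𝓝[>] 0, r * C < δ := by
  have h : Tendsto (fun r : ℝ => r * C) (𝓝 0) (𝓝 0) :=
    (continuous_id.mul_const C).tendsto' 0 0 (zero_mul C)
  exact (h.mono_left nhdsWithin_le_nhds).eventually_lt_const hδ

theorem tendsto_measureReal_ball (hK : 1 ≤ K) (t₀ : UnitAddTorus (Fin K)) :
    Tendsto (fun r : ℝ => volume.real (Metric.ball t₀ r)) (𝓝[>] 0) (𝓝 0) := by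
  have : NullSingletonClass (volume : Measure UnitAddCircle) :=
    ⟨fun x => by
      have h := AddCircle.volume_closedBall (T := 1) (x := x) 0
      simpa using h⟩
  have : NullSingletonClass (volume : Measure (UnitAddTorus (Fin K))) :=
    Measure.pi_nullSingletonClass (⟨0, hK⟩ : Fin K)
  have h := tendsto_measure_cthickening_of_isClosed (μ := volume) (s := {t₀})
    ⟨1, one_pos, measure_ne_top _ _⟩ isClosed_singleton
  rw [measure_singleton] at h
  have h' := (ENNReal.tendsto_toReal ENNReal.zero_ne_top).comp h
  refine squeeze_zero' (Eventually.of_forall fun _ => measureReal_nonneg) ?_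
    (h'.mono_left nhdsWithin_le_nhds)
  filter_upwards [self_mem_nhdsWithin] with r hr
  refine measureReal_mono (s₂ := Metric.cthickening r {t₀}) ?_
  rw [Metric.cthickening_singleton _ (le_of_lt hr)]
  exact Metric.ball_subset_closedBall

/-- The labels along a finite piece of orbit can be prescribed on a small ball, by an
arbitrarily small change of the partition. -/
theorem eventually_exists_prescribed [Fintype A] (hK : 1 ≤ K)
    {τ : ZLat D →+ UnitAddTorus (Fin K)} (hτ : Function.Injective τ) (B : Finset (ZLat D))
    (P : MPartition K A) (t₀ : UnitAddTorus (Fin K)) (c : B → A) {ε : ℝ} (hε : 0 < ε) :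
    ∀ᶠ r : ℝ in 𝓝[>] 0, ∃ P' : MPartition K A, dist P P' < ε ∧
      (∀ t ∈ Metric.ball t₀ r, ∀ b : B, t + τ b ∈ P'.cell (c b)) ∧
      ∀ t, (∀ b : B, t - τ b ∉ Metric.ball t₀ r) → ∀ a, t ∈ P'.cell a ↔ t ∈ P.cell a := by
  classical
  have hmeas : ∀ᶠ r : ℝ in 𝓝[>] 0,
      Fintype.card A * (B.card * volume.real (Metric.ball t₀ r)) < ε := by
    have h := ((tendsto_measureReal_ball hK t₀).const_mul (B.card : ℝ)).const_mul
      (Fintype.card A : ℝ)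
    simp only [mul_zero] at h
    exact h.eventually_lt_const hε
  -- For such `r` the balls of radius `r` about the points `t₀ + τ b` are disjoint, so the
  -- prescriptions do not conflict. Injectivity of `τ` separates the centres.
  have hsep : ∀ᶠ r : ℝ in 𝓝[>] 0, ∀ b : B, ∀ b' : B, b ≠ b' → r * 2 < ‖τ b - τ b'‖ := by
    refine eventually_all.2 fun b => eventually_all.2 fun b' => ?_
    by_cases hb : b = b'
    · exact Eventually.of_forall fun _ h => absurd hb h
    · have hpos : 0 < ‖τ b - τ b'‖ :=
        norm_pos_iff.2 (sub_ne_zero.2 fun h => hb (Subtype.ext (hτ h)))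
      filter_upwards [eventually_mul_lt 2 hpos] with r hr _ using hr
  filter_upwards [hmeas, hsep] with r hr hs
  let T : B → Set (UnitAddTorus (Fin K)) := fun b => (fun t => t - τ b) ⁻¹' Metric.ball t₀ r
  let M : Set (UnitAddTorus (Fin K)) := ⋃ b, T b
  have hTm : ∀ b, MeasurableSet (T b) := fun b =>
    (measurable_id.sub_const _) Metric.isOpen_ball.measurableSet
  have hMm : MeasurableSet M := MeasurableSet.iUnion hTm
  have hTd : ∀ b b' t, t ∈ T b → t ∈ T b' → b = b' := by
    intro b b' t h h'
    by_contra hne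
    have h1 := hs b b' hne
    simp only [T, mem_preimage, Metric.mem_ball, dist_eq_norm] at h h'
    have h2 : τ b - τ b' = (t - τ b' - t₀) - (t - τ b - t₀) := by abel
    rw [h2] at h1
    linarith [norm_sub_le (t - τ b' - t₀) (t - τ b - t₀)]
  let P' : MPartition K A :=
    { cell := fun a => (P.cell a \ M) ∪ ⋃ (b) (_ : c b = a), T b
      measurableSet_cell := fun a => ((P.measurableSet_cell a).diff hMm).union
        (MeasurableSet.iUnion fun b => MeasurableSet.iUnion fun _ => hTm b)
      disjoint_cell := by
        intro a a' hne
        refine Set.disjoint_left.2 fun t h h' => hne ?_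
        simp only [mem_union, Set.mem_sdiff, mem_iUnion, exists_prop] at h h'
        rcases h with ⟨h1, h2⟩ | ⟨b, rfl, h1⟩ <;> rcases h' with ⟨h3, h4⟩ | ⟨b', rfl, h3⟩
        · exact eq_of_mem_cell h1 h3
        · exact absurd (mem_iUnion.2 ⟨b', h3⟩) h2
        · exact absurd (mem_iUnion.2 ⟨b, h1⟩) h4
        · rw [hTd b b' t h1 h3]
      volume_iUnion_cell := by
        refine le_antisymm prob_le_one ?_
        rw [← P.volume_iUnion_cell]
        refine measure_mono fun t ht => ?_
        obtain ⟨a, ha⟩ := mem_iUnion.1 ht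
        by_cases hM : t ∈ M
        · obtain ⟨b, hb⟩ := mem_iUnion.1 hM
          exact mem_iUnion.2 ⟨c b, Or.inr (mem_iUnion₂.2 ⟨b, rfl, hb⟩)⟩
        · exact mem_iUnion.2 ⟨a, Or.inl ⟨ha, hM⟩⟩ }
  have hout : ∀ t ∉ M, ∀ a, t ∈ P'.cell a ↔ t ∈ P.cell a := by
    intro t ht a
    refine ⟨?_, fun h => Or.inl ⟨h, ht⟩⟩
    rintro (h | h)
    · exact h.1
    · obtain ⟨b, -, hb⟩ := mem_iUnion₂.1 h
      exact absurd (mem_iUnion.2 ⟨b, hb⟩) ht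
  refine ⟨P', lt_of_le_of_lt (dist_le_card_mul (W := M) ?_) (lt_of_le_of_lt ?_ hr), ?_, ?_⟩
  · intro a t ht
    by_contra hM
    have := hout t hM a
    rw [mem_symmDiff] at ht
    tauto
  · gcongr
    refine (measureReal_iUnion_fintype_le _).trans ?_
    have : ∀ b, volume.real (T b) = volume.real (Metric.ball t₀ r) := fun b => by
      rw [measureReal_def, measureReal_def, (measurePreserving_sub_right volume (τ b)).measure_preimage
        Metric.isOpen_ball.measurableSet.nullMeasurableSet]
    simp [this]
  · intro t ht b
    refine Or.inr (mem_iUnion₂.2 ⟨b, rfl, ?_⟩)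
    simpa [T] using ht
  · intro t ht a
    refine hout t (fun hM => ?_) a
    obtain ⟨b, hb⟩ := mem_iUnion.1 hM
    exact ht b hb

/-! ### Density -/

/-- By Baire it suffices to treat one basic open set `U` and one label `a`. A block `c` with `φ c ≠
a`, prescribed near a point of `U`, gives the image another label on a ball in `U`. -/
theorem dense_setOf_isNowhereOpen_induced [Fintype A] (hK : 1 ≤ K)
    {τ : ZLat D →+ UnitAddTorus (Fin K)} (hτ : Function.Injective τ) {B : Finset (ZLat D)}
    {φ : (B → A) → A} (hφ : ∀ a, ∃ c, φ c ≠ a) :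
    Dense {P : MPartition K A | (induced τ B φ P).IsNowhereOpen} := by
  have := (TopologicalSpace.countable_countableBasis (UnitAddTorus (Fin K))).to_subtype
  have hbas := TopologicalSpace.isBasis_countableBasis (UnitAddTorus (Fin K))
  change Dense (induced τ B φ ⁻¹' {P : MPartition K A | P.IsNowhereOpen})
  simp only [setOf_isNowhereOpen_eq, preimage_iInter]
  have ho : ∀ (U : TopologicalSpace.countableBasis (UnitAddTorus (Fin K))) (a : A),
      IsOpen (induced τ B φ ⁻¹' {P | volume.real ((U : Set _) \ P.cell a) ≠ 0}) := fun U a =>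
    (isOpen_ne_fun (continuous_measureReal_sdiff_cell _ a) continuous_const).preimage
      (continuous_induced τ B φ)
  refine dense_iInter_of_isOpen (fun U => isOpen_iInter_of_finite (ho U)) fun U =>
    dense_iInter_of_isOpen (ho U) fun a => Metric.dense_iff.2 fun P ε hε => ?_
  obtain ⟨t₀, ht₀⟩ := TopologicalSpace.nonempty_of_mem_countableBasis U.2
  obtain ⟨ρ, hρ, hU⟩ := Metric.isOpen_iff.1 (hbas.isOpen U.2) t₀ ht₀
  obtain ⟨c, hc⟩ := hφ a
  obtain ⟨r, ⟨P', hd, hin, -⟩, hrρ, hr⟩ :=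
    ((eventually_exists_prescribed hK hτ B P t₀ c hε).and
      (Ioo_mem_nhdsGT hρ |> fun h => (show ∀ᶠ r in 𝓝[>] (0 : ℝ), r < ρ ∧ 0 < r by
        filter_upwards [h] with r hr using ⟨hr.2, hr.1⟩))).exists
  refine ⟨P', by rwa [Metric.mem_ball, dist_comm], ?_⟩
  change volume.real _ ≠ 0
  rw [Ne, measureReal_eq_zero_iff]
  intro h0
  refine (Metric.measure_ball_pos volume t₀ hr).ne' (measure_mono_null ?_ h0)
  intro t ht
  refine ⟨hU (Metric.ball_subset_ball hrρ.le ht), fun h => hc ?_⟩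
  have h' : t ∈ (induced τ B φ P').cell (φ c) := mem_cell_induced.2 ⟨c, rfl, hin t ht⟩
  exact eq_of_mem_cell h' h

theorem ae_eq_preimage_nsmul [Fintype A] {Q : MPartition K A} {s : UnitAddTorus (Fin K)}
    (hs : dist (Q.translate s) Q = 0) (a : A) (j : ℕ) :
    (fun t => t + j • s) ⁻¹' Q.cell a =ᵐ[volume] Q.cell a := by
  induction j with
  | zero =>
    simp only [zero_nsmul, add_zero, preimage_id']
    exact ae_eq_refl _
  | succ j ih =>
    have h1 : (fun t => t + s) ⁻¹' Q.cell a =ᵐ[volume] Q.cell a := dist_eq_zero_iff.1 hs a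
    have h2 := (measurePreserving_add_right volume (j • s)).quasiMeasurePreserving.preimage_ae_eq h1
    have h3 : (fun t => t + (j + 1) • s) ⁻¹' Q.cell a =
        (fun t => t + j • s) ⁻¹' ((fun t => t + s) ⁻¹' Q.cell a) := by
      ext t
      simp [succ_nsmul, add_assoc]
    rw [h3]
    exact h2.trans ih

/-- Since `ℤ^D` is torsion-free, each pair `f ≠ 0`, `f'` excludes at most one `m`. The purpose is
that `s` and `m • s` cannot both lie close to `τ` of a nonzero element of `F` and of an element of
`F`, respectively. -/
theorem exists_nsmul_ne (F : Finset (ZLat D)) :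
    ∃ m : ℕ, ∀ f ∈ F, f ≠ 0 → ∀ f' ∈ F, m • f ≠ f' := by
  have h : ∀ᶠ m : ℕ in cofinite, ∀ f ∈ F, ∀ f' ∈ F, f ≠ 0 → m • f ≠ f' := by
    rw [eventually_all_finset]
    intro f _
    rw [eventually_all_finset]
    intro f' _
    by_cases hf : f = 0
    · exact Eventually.of_forall fun _ h => absurd hf h
    · refine (Set.Subsingleton.finite fun m hm m' hm' => ?_ :
        {m : ℕ | ¬ (f ≠ 0 → m • f ≠ f')}.Finite)
      simp only [mem_ofPred_eq, not_forall, not_not] at hm hm'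
      obtain ⟨_, hm⟩ := hm
      obtain ⟨_, hm'⟩ := hm'
      have h := hm.trans hm'.symm
      rw [← natCast_zsmul, ← natCast_zsmul f m'] at h
      exact Nat.cast_injective (R := ℤ) (smul_left_injective ℤ hf h)
  obtain ⟨m, hm⟩ := h.exists
  exact ⟨m, fun f hf h0 f' hf' => hm f hf f' hf' h0⟩

/-- Prescribing `c` near `0` gives the image the constant label `φ c` on a ball. A symmetry `s` with
`ρ ≤ ‖s‖` has a multiple `j • s` that carries this ball to where the old and new images agree. There
the old image would have an open piece of constant label, against `hP`. -/
theorem exists_induced_mem_simpleAwayFrom [Fintype A] (hK : 1 ≤ K)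
    {τ : ZLat D →+ UnitAddTorus (Fin K)} (hτ : Function.Injective τ) {B : Finset (ZLat D)}
    {φ : (B → A) → A} {P : MPartition K A} (hP : (induced τ B φ P).IsNowhereOpen) (c : B → A)
    {ε ρ : ℝ} (hε : 0 < ε) (hρ : 0 < ρ) :
    ∃ P' : MPartition K A, dist P P' < ε ∧ induced τ B φ P' ∈ simpleAwayFrom K A ρ := by
  classical
  -- The change near `0` alters the image only near the points `τ f` with `f ∈ F`.
  let F : Finset (ZLat D) := (B ×ˢ B).image fun p => p.1 - p.2
  obtain ⟨m, hm⟩ := exists_nsmul_ne F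
  -- If `s` is within `2 * r` of `τ f` and `m • s` within `2 * r` of `τ f'`, then `τ (m • f - f')`
  -- has norm less than `r * (2 * m + 2)`.
  have hsep : ∀ᶠ r : ℝ in 𝓝[>] 0, ∀ f ∈ F, ∀ f' ∈ F, f ≠ 0 →
      r * (2 * m + 2) < ‖τ (m • f - f')‖ := by
    rw [eventually_all_finset]
    intro f hf
    rw [eventually_all_finset]
    intro f' hf'
    by_cases h0 : f = 0
    · exact Eventually.of_forall fun _ h => absurd h0 h
    · have hpos : 0 < ‖τ (m • f - f')‖ := by
        rw [norm_pos_iff]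
        exact (map_ne_zero_iff τ hτ).2 (sub_ne_zero.2 (hm f hf h0 f' hf'))
      filter_upwards [eventually_mul_lt (2 * m + 2) hpos] with r hr _ using hr
  obtain ⟨r, ⟨⟨P', hd, hin, hout⟩, hr2⟩, hrsep, hr⟩ :=
    (((eventually_exists_prescribed hK hτ B P 0 c hε).and (eventually_mul_lt 2 hρ)).and
      (hsep.and self_mem_nhdsWithin)).exists
  have hr0 : 0 < r := hr
  refine ⟨P', hd, fun s hs hsym => ?_⟩
  -- One of `j = 1` and `j = m` works; `f = 0` is impossible for `j = 1`, as `‖s‖ ≥ ρ > 2 * r`.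
  obtain ⟨j, hj⟩ : ∃ j : ℕ, ∀ f ∈ F, r * 2 ≤ ‖j • s - τ f‖ := by
    by_contra! hcon
    obtain ⟨f, hf, h1⟩ := hcon 1
    obtain ⟨f', hf', h2⟩ := hcon m
    rw [one_nsmul] at h1
    have hf0 : f ≠ 0 := by
      rintro rfl
      rw [map_zero, sub_zero] at h1
      linarith
    have h3 := hrsep f hf f' hf' hf0
    have h4 : τ (m • f - f') = (m • s - τ f') - m • (s - τ f) := by
      rw [map_sub, map_nsmul, nsmul_sub]; abel
    rw [h4] at h3
    have h5 := norm_sub_le (m • s - τ f') (m • (s - τ f))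
    have h6 : ‖m • (s - τ f)‖ ≤ m * ‖s - τ f‖ := norm_nsmul_le
    have h7 : (m : ℝ) * ‖s - τ f‖ ≤ m * (r * 2) := by gcongr
    linarith
  let U : Set (UnitAddTorus (Fin K)) := (fun t => t - j • s) ⁻¹' Metric.ball 0 r
  have hUo : IsOpen U := Metric.isOpen_ball.preimage (by fun_prop)
  have hUne : U.Nonempty := ⟨j • s, by simpa [U] using hr0⟩
  refine hP U hUo hUne (φ c) ?_
  have hagree : ∀ t ∈ U, t ∈ (induced τ B φ P').cell (φ c) → t ∈ (induced τ B φ P).cell (φ c) := by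
    intro t ht h
    obtain ⟨c', hc', hcell⟩ := mem_cell_induced.1 h
    refine mem_cell_induced.2 ⟨c', hc', fun b => (hout _ (fun b' hb' => ?_) _).1 (hcell b)⟩
    have hF : (b' : ZLat D) - b ∈ F :=
      Finset.mem_image.2 ⟨(b', b), Finset.mem_product.2 ⟨b'.2, b.2⟩, rfl⟩
    have h1 := hj _ hF
    have h2 : j • s - τ ((b' : ZLat D) - b) = (t + τ b - τ b') - (t - j • s) := by
      rw [map_sub]; abel
    rw [h2] at h1
    have h3 : ‖t - j • s‖ < r := by simpa [U] using ht
    have h4 : ‖t + τ b - τ b'‖ < r := by simpa using hb'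
    linarith [norm_sub_le (t + τ b - τ b') (t - j • s)]
  let E : Set (UnitAddTorus (Fin K)) := (fun t => t + j • s) ⁻¹' (induced τ B φ P').cell (φ c)
  have hE : MeasurableSet E :=
    (measurable_id.add_const (j • s)) ((induced τ B φ P').measurableSet_cell (φ c))
  have hnull : volume (Metric.ball 0 r \ E) = 0 := by
    refine measure_mono_null (fun t ht => ?_)
      (ae_le_set.1 (ae_eq_preimage_nsmul hsym (φ c) j).symm.le)
    exact ⟨mem_cell_induced.2 ⟨c, rfl, hin t ht.1⟩, ht.2⟩
  rw [← (measurePreserving_sub_right volume (j • s)).measure_preimage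
    (Metric.isOpen_ball.measurableSet.diff hE).nullMeasurableSet] at hnull
  refine measure_mono_null (fun t ht => ?_) hnull
  refine ⟨ht.1, fun h => ht.2 (hagree t ht.1 ?_)⟩
  simpa [E] using h

theorem dense_setOf_isSimple_induced [Fintype A] (hK : 1 ≤ K)
    {τ : ZLat D →+ UnitAddTorus (Fin K)} (hτ : Function.Injective τ) {B : Finset (ZLat D)}
    {φ : (B → A) → A} (hφ : ∀ a, ∃ c, φ c ≠ a) :
    Dense {P : MPartition K A | (induced τ B φ P).IsSimple} := by
  change Dense (induced τ B φ ⁻¹' {P : MPartition K A | P.IsSimple})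
  rw [setOf_isSimple_eq, preimage_iInter]
  refine dense_iInter_of_isOpen
    (fun k => (isOpen_simpleAwayFrom _).preimage (continuous_induced τ B φ)) fun k =>
    Metric.dense_iff.2 fun P ε hε => ?_
  obtain ⟨P₁, hP₁, hN⟩ :=
    Metric.dense_iff.1 (dense_setOf_isNowhereOpen_induced hK hτ hφ) P (ε / 2) (half_pos hε)
  -- Only some label is needed, to have a block to prescribe; which one is irrelevant.
  obtain ⟨t, ht⟩ := P.ae_mem_iUnion_cell.exists
  obtain ⟨a, -⟩ := mem_iUnion.1 ht
  obtain ⟨P₂, h2, hS⟩ := exists_induced_mem_simpleAwayFrom hK hτ hN (fun _ => a) (half_pos hε)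
    (Nat.one_div_pos_of_nat (n := k) : (0 : ℝ) < _)
  refine ⟨P₂, ?_, hS⟩
  rw [Metric.mem_ball, dist_comm] at hP₁ ⊢
  linarith [dist_triangle P P₁ P₂]

theorem isTrivial_induced_of_const [Finite A] (τ : ZLat D →+ UnitAddTorus (Fin K))
    {B : Finset (ZLat D)} {φ : (B → A) → A} {a : A} (hφ : ∀ c, φ c = a) (P : MPartition K A) :
    (induced τ B φ P).IsTrivial := by
  refine ⟨a, mem_ae_iff.1 ?_⟩
  filter_upwards [(induced τ B φ P).ae_mem_iUnion_cell] with t ht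
  obtain ⟨a', ha'⟩ := mem_iUnion.1 ht
  obtain ⟨c, rfl, -⟩ := mem_cell_induced.1 ha'
  rwa [hφ c] at ha'

theorem dense_setOf_isTrivial_or_isSimple_induced [Fintype A] (hK : 1 ≤ K)
    {τ : ZLat D →+ UnitAddTorus (Fin K)} (hτ : Function.Injective τ) (B : Finset (ZLat D))
    (φ : (B → A) → A) :
    Dense {P : MPartition K A | (induced τ B φ P).IsTrivial ∨
      (induced τ B φ P).IsSimple ∧ (induced τ B φ P).IsNowhereOpen} := by
  by_cases h : ∃ a, ∀ c, φ c = a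
  · obtain ⟨a, ha⟩ := h
    refine dense_univ.mono fun P _ => Or.inl (isTrivial_induced_of_const τ ha P)
  · push Not at h
    refine (Dense.inter_of_Gδ ?_ ?_ (dense_setOf_isSimple_induced hK hτ h)
      (dense_setOf_isNowhereOpen_induced hK hτ h)).mono fun P hP => Or.inr hP
    · exact isGδ_setOf_isSimple.preimage (continuous_induced τ B φ)
    · exact isGδ_setOf_isNowhereOpen.preimage (continuous_induced τ B φ)

end MPartition

namespace MPartition

variable {D K : ℕ} {A : Type*} {τ : ZLat D →+ UnitAddTorus (Fin K)}

/-! ### Trajectories of simple partitions -/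

theorem translate_zero [Finite A] (P : MPartition K A) : P.translate 0 = P := by
  cases P
  simp [translate]

theorem translate_sub_translate [Finite A] (P : MPartition K A) (x y : UnitAddTorus (Fin K)) :
    (P.translate (x - y)).translate y = P.translate x := by
  have h : ∀ a, (fun t => t + y) ⁻¹' ((fun t => t + (x - y)) ⁻¹' P.cell a) =
      (fun t => t + x) ⁻¹' P.cell a := fun a => by
    ext t
    simp
  simp only [translate, h]

/-- The trajectory with respect to a simple partition determines the point, almost everywhere.
Along lattice points `ℓ k x` with `τ (ℓ k x) → x` fast, the labels of `t + τ (ℓ k x)` are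
eventually equal to the label of `t + x`, for almost all `t` and `x`; thus the labels of the
orbit of `t` determine the labels of almost all points. -/
theorem IsSimple.ae_injective [Fintype A] (hτd : DenseRange τ) {Q : MPartition K A}
    (hQ : Q.IsSimple) :
    ∃ E : Set (UnitAddTorus (Fin K)), (∀ᵐ t, t ∈ E) ∧
      ∀ t ∈ E, ∀ t' ∈ E, ∀ x : Config D A, Q.IsTraj τ t x → Q.IsTraj τ t' x → t = t' := by
  classical
  obtain ⟨e, he⟩ := exists_surjective_nat (ZLat D)
  have hδ : ∀ k : ℕ, ∃ δ > 0, ∀ s, ‖s‖ < δ → dist (Q.translate s) Q < (1 / 2) ^ k := by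
    intro k
    have h := Metric.continuousAt_iff.1 (Q.continuous_translate.continuousAt (x := 0))
      ((1 / 2) ^ k) (by positivity)
    simpa [translate_zero] using h
  choose δ hδ0 hδ using hδ
  have hex : ∀ (k : ℕ) (x : UnitAddTorus (Fin K)), ∃ n, dist x (τ (e n)) < δ k := by
    intro k x
    obtain ⟨l, hl⟩ := hτd.exists_dist_lt x (hδ0 k)
    obtain ⟨n, rfl⟩ := he l
    exact ⟨n, hl⟩
  -- Taking the first suitable lattice point in an enumeration makes the choice measurable in `x`,
  -- as the Fubini argument below requires.
  let ℓ : ℕ → UnitAddTorus (Fin K) → ZLat D := fun k x => e (Nat.find (hex k x))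
  have hℓ : ∀ k x, dist x (τ (ℓ k x)) < δ k := fun k x => Nat.find_spec (hex k x)
  have hℓm : ∀ k, Measurable fun x => τ (ℓ k x) := fun k =>
    (measurable_from_nat (f := fun n => τ (e n))).comp (measurable_find (hex k) fun n =>
      (isOpen_lt (continuous_id.dist continuous_const) continuous_const).measurableSet)
  let good : UnitAddTorus (Fin K) → UnitAddTorus (Fin K) → Prop := fun t x =>
    ∀ᶠ k in atTop, ∀ a, t + x ∈ Q.cell a ↔ t + τ (ℓ k x) ∈ Q.cell a
  have hgood : ∀ x, ∀ᵐ t, good t x := by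
    intro x
    have hd : ∀ k, dist (Q.translate x) (Q.translate (τ (ℓ k x))) < (1 / 2) ^ k := by
      intro k
      rw [← translate_sub_translate Q x (τ (ℓ k x)), dist_translate_translate]
      exact hδ k _ (by rw [← dist_eq_norm]; exact hℓ k x)
    have hv : ∀ k, volume ((Q.translate x).diffSet (Q.translate (τ (ℓ k x)))) ≤
        ENNReal.ofReal ((1 / 2) ^ k) := fun k => by
      rw [← ofReal_measureReal]
      exact ENNReal.ofReal_le_ofReal ((measureReal_diffSet_le_dist _ _).trans (hd k).le)
    have hsum : ∑' k, volume ((Q.translate x).diffSet (Q.translate (τ (ℓ k x)))) ≠ ∞ := by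
      refine ne_top_of_le_ne_top ?_ (ENNReal.tsum_le_tsum hv)
      rw [← ENNReal.ofReal_tsum_of_nonneg (fun n => by positivity) summable_geometric_two]
      exact ENNReal.ofReal_ne_top
    filter_upwards [ae_eventually_notMem hsum] with t ht
    filter_upwards [ht] with k hk a
    exact mem_cell_iff_of_notMem_diffSet hk a
  have hmeas : MeasurableSet
      {p : UnitAddTorus (Fin K) × UnitAddTorus (Fin K) | good p.2 p.1} := by
    have : {p : UnitAddTorus (Fin K) × UnitAddTorus (Fin K) | good p.2 p.1} =
        ⋃ N : ℕ, ⋂ k ≥ N, ⋂ a, {p | p.2 + p.1 ∈ Q.cell a ↔ p.2 + τ (ℓ k p.1) ∈ Q.cell a} := by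
      ext p
      simp [good, eventually_atTop]
    rw [this]
    refine MeasurableSet.iUnion fun N => MeasurableSet.iInter fun k => MeasurableSet.iInter fun _ =>
      MeasurableSet.iInter fun a => ?_
    exact MeasurableSet.iff ((measurable_snd.add measurable_fst) (Q.measurableSet_cell a))
      ((measurable_snd.add ((hℓm k).comp measurable_fst)) (Q.measurableSet_cell a))
  refine ⟨{t | ∀ᵐ x, good t x}, ?_, ?_⟩
  · exact (Measure.ae_ae_comm hmeas).1 (Eventually.of_forall hgood)
  · intro t ht t' ht' x hx hx'
    -- Equal trajectories make `t - t'` a symmetry of `Q`, so simplicity forces it to vanish.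
    refine sub_eq_zero.1 (hQ _ (dist_eq_zero_iff.2 fun a => ?_))
    have hor : ∀ l, t + τ l ∈ Q.cell a ↔ t' + τ l ∈ Q.cell a := fun l =>
      ⟨fun h => eq_of_mem_cell (hx l) h ▸ hx' l, fun h => eq_of_mem_cell (hx' l) h ▸ hx l⟩
    have hae : ∀ᵐ y, t + y ∈ Q.cell a ↔ t' + y ∈ Q.cell a := by
      filter_upwards [ht, ht'] with y hy hy'
      obtain ⟨k, hk, hk'⟩ := (Eventually.and hy hy').exists
      rw [hk a, hk' a, hor]
    have hae' := (measurePreserving_sub_right volume t').quasiMeasurePreserving.ae hae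
    filter_upwards [hae'] with u hu
    refine propext ?_
    have h1 : t + (u - t') = u + (t - t') := by abel
    rw [h1, add_sub_cancel] at hu
    exact hu

theorem measurableSet_domain [Finite A] (P : MPartition K A) : MeasurableSet (P.domain τ) := by
  have : P.domain τ = ⋂ l, (fun t => t + τ l) ⁻¹' ⋃ a, P.cell a := by
    ext t
    simp [domain]
  rw [this]
  exact MeasurableSet.iInter fun l =>
    (measurable_id.add_const _) (MeasurableSet.iUnion P.measurableSet_cell)

theorem ae_domain_of_ae [Finite A] (P : MPartition K A) {p : UnitAddTorus (Fin K) → Prop}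
    (h : ∀ᵐ t, p t) :
    ∀ᵐ t : P.domain τ ∂((volume : Measure (UnitAddTorus (Fin K))).comap Subtype.val), p t :=
  (ae_restrict_iff_subtype P.measurableSet_domain).1 (ae_restrict_of_ae h)

/-! ### The automaton on the quasisturmian measure -/

section Measure

variable [Fintype A] [MeasurableSpace A] [MeasurableSingletonClass A]
  {Φ : Config D A → Config D A} {B : Finset (ZLat D)} {φ : (B → A) → A}

theorem ae_qsMeasure_const (hφ : IsLocalMap Φ B φ) {P : MPartition K A}
    (hP : (induced τ B φ P).IsTrivial) : ∃ y, ∀ᵐ x ∂P.qsMeasure τ, Φ x = y := by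
  obtain ⟨a, ha⟩ := hP
  refine ⟨fun _ => a, ?_⟩
  have hset : {x : Config D A | Φ x = fun _ => a} =
      ⋂ l, (fun x : Config D A => fun b : B => x (l + b)) ⁻¹' (φ ⁻¹' {a}) := by
    ext x
    simp [funext_iff, hφ x]
  have hm : MeasurableSet {x : Config D A | Φ x = fun _ => a} := by
    rw [hset]
    refine MeasurableSet.iInter fun l => ?_
    refine (measurable_pi_lambda _ fun b => measurable_pi_apply _) ?_
    exact (Set.toFinite _).measurableSet
  refine (ae_map_iff (P.measurable_traj τ).aemeasurable hm).2 ?_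
  have hae : ∀ᵐ t, ∀ l, t + τ l ∈ (induced τ B φ P).cell a := ae_all_iff.2 fun l =>
    (measurePreserving_add_right volume (τ l)).quasiMeasurePreserving.ae (mem_ae_iff.2 ha)
  filter_upwards [P.ae_domain_of_ae hae] with t ht
  exact funext fun l => eq_of_mem_cell ((P.isTraj_traj t).induced hφ l) (ht l)

/-- On almost all points, `Φ` of the `P`-trajectory is a trajectory of the simple induced partition
and so determines the point, hence the `P`-trajectory itself. -/
theorem ae_qsMeasure_injOn (hτd : DenseRange τ) (hφ : IsLocalMap Φ B φ) {P : MPartition K A}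
    (hP : (induced τ B φ P).IsSimple) :
    ∃ S : Set (Config D A), (∀ᵐ x ∂P.qsMeasure τ, x ∈ S) ∧ InjOn Φ S := by
  obtain ⟨E, hE, hinj⟩ := hP.ae_injective hτd
  obtain ⟨E', hE', hE'm, hE'E⟩ := hE.exists_measurable_mem
  have hΦinj : ∀ t t' : P.domain τ, (t : UnitAddTorus (Fin K)) ∈ E' →
      (t' : UnitAddTorus (Fin K)) ∈ E' → Φ (P.traj τ t) = Φ (P.traj τ t') → t = t' := by
    intro t t' ht ht' h
    refine Subtype.ext (hinj t (hE'E _ ht) t' (hE'E _ ht') _ ((P.isTraj_traj t).induced hφ) ?_)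
    rw [h]
    exact (P.isTraj_traj t').induced hφ
  -- By Lusin–Souslin, the injective measurable image of a measurable subset of this standard Borel
  -- space is measurable, so its measure can be computed by pulling back.
  have := P.measurableSet_domain (τ := τ).standardBorel
  refine ⟨P.traj τ '' (Subtype.val ⁻¹' E'), ?_, ?_⟩
  · have hm : MeasurableSet (P.traj τ '' (Subtype.val ⁻¹' E')) :=
      (measurable_subtype_coe hE'm).image_of_measurable_injOn (P.measurable_traj τ)
        fun t ht t' ht' h => hΦinj t t' ht ht' (congrArg Φ h)
    refine (ae_map_iff (P.measurable_traj τ).aemeasurable hm).2 ?_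
    filter_upwards [P.ae_domain_of_ae hE'] with t ht
    exact mem_image_of_mem _ ht
  · rintro _ ⟨t, ht, rfl⟩ _ ⟨t', ht', rfl⟩ h
    rw [hΦinj t t' ht ht' h]

end Measure

end MPartition

theorem IsCellularAutomaton.iterate {D : ℕ} {A : Type*} [TopologicalSpace A]
    {Φ : Config D A → Config D A} (hΦ : IsCellularAutomaton Φ) (n : ℕ) :
    IsCellularAutomaton Φ^[n] :=
  ⟨hΦ.continuous.iterate n, fun v x =>
    (Function.Commute.iterate_left (f := Φ) (g := shift v) (hΦ.shift_comm v) n) x⟩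

namespace MPartition

variable {D K : ℕ} {A : Type*} {τ : ZLat D →+ UnitAddTorus (Fin K)}

/-! ### Shifts of open partitions -/

/-- The cells other than the full one are null and open, hence empty, so no exceptional trajectory
can occur. -/
theorem IsOpenPartition.qsShift_subset_singleton [TopologicalSpace A] [DiscreteTopology A]
    {P : MPartition K A} (hP : P.IsOpenPartition)
    (hT : P.IsTrivial) : ∃ y : Config D A, P.qsShift τ ⊆ {y} := by
  obtain ⟨a, ha⟩ := hT
  refine ⟨fun _ => a, closure_minimal ?_ isClosed_singleton⟩
  rintro _ ⟨t, rfl⟩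
  refine funext fun l => ?_
  by_contra hne
  have h0 : volume (P.cell (P.traj τ t l)) = 0 :=
    measure_mono_null (Set.disjoint_left.1 (P.disjoint_cell hne)) ha
  have he := ((hP.1 _).measure_eq_zero_iff volume).1 h0
  have hmem := P.isTraj_traj t l
  rw [he] at hmem
  exact hmem

theorem IsOpenPartition.not_isNowhereOpen [Finite A] {P : MPartition K A} (hP : P.IsOpenPartition) :
    ¬ P.IsNowhereOpen := by
  intro hN
  obtain ⟨t, ht⟩ := P.ae_mem_iUnion_cell.exists
  obtain ⟨a, ha⟩ := mem_iUnion.1 ht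
  exact hN _ (hP.1 a) ⟨t, ha⟩ a (by simp)

/-- For an open partition, trajectories of almost all points are dense in the shift. -/
theorem IsOpenPartition.qsShift_subset_of_ae [Finite A] [TopologicalSpace A]
    {P : MPartition K A} (hP : P.IsOpenPartition)
    {Z : Set (Config D A)} (hZ : IsClosed Z) (h : ∀ᵐ t, ∀ x, P.IsTraj τ t x → x ∈ Z) :
    P.qsShift τ ⊆ Z := by
  refine closure_minimal ?_ hZ
  rintro _ ⟨t, rfl⟩
  rw [← hZ.closure_eq]
  refine mem_closure_iff.2 fun o ho hto => ?_
  obtain ⟨F, u, hu, hsub⟩ := isOpen_pi_iff.1 ho _ hto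
  -- Points of `U` share the labels of `t` on the window `F`. As `U` is open and nonempty it has
  -- positive measure, so it contains a point from the given full-measure set.
  let U : Set (UnitAddTorus (Fin K)) :=
    ⋂ l ∈ F, (fun s => s + τ l) ⁻¹' P.cell (P.traj τ t l)
  have hU : IsOpen U := isOpen_biInter_finset fun l _ =>
    (hP.1 _).preimage (continuous_id.add continuous_const)
  have htU : (t : UnitAddTorus (Fin K)) ∈ U := mem_iInter₂.2 fun l _ => P.isTraj_traj t l
  have hpos : volume U ≠ 0 := (hU.measure_pos volume ⟨t, htU⟩).ne'
  obtain ⟨s, hsU, hs, hsx⟩ := ((frequently_ae_mem_iff.2 hpos).and_eventually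
    (h.and (P.ae_exists_isTraj τ))).exists
  obtain ⟨x, hx⟩ := hsx
  refine ⟨x, hsub fun l hl => ?_, hs x hx⟩
  rw [eq_of_mem_cell (hx l) (mem_iInter₂.1 hsU l hl)]
  exact (hu l hl).2

/-- The identity recovering `x` from `Φ x` through `ψ` holds for trajectories of almost all points
and defines a closed set `Z`, so it holds on the whole shift. -/
theorem IsOpenPartition.injOn_qsShift [Fintype A] [TopologicalSpace A] [DiscreteTopology A]
    {Φ : Config D A → Config D A} (hΦ : Continuous Φ)
    {B W : Finset (ZLat D)} {φ : (B → A) → A} (hφ : IsLocalMap Φ B φ) {P : MPartition K A}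
    (hP : P.IsOpenPartition) (hR : P.IsRecoverable τ B φ W) : InjOn Φ (P.qsShift τ) := by
  obtain ⟨ψ, hψ⟩ := hR
  let Z : Set (Config D A) := ⋂ l, {x | x l = ψ fun w => Φ x (l + w)}
  have hZ : IsClosed Z := isClosed_iInter fun l => isClosed_eq (continuous_apply l)
    ((continuous_of_discreteTopology (f := ψ)).comp
      (continuous_pi fun w => (continuous_apply _).comp hΦ))
  have hsub : P.qsShift τ ⊆ Z := by
    refine hP.qsShift_subset_of_ae hZ ?_
    have hae : ∀ᵐ t, ∀ l a,
        t + τ l ∈ (induced τ W ψ (induced τ B φ P)).cell a ↔ t + τ l ∈ P.cell a :=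
      ae_all_iff.2 fun l => ae_all_iff.2 fun a =>
        (measurePreserving_add_right volume (τ l)).quasiMeasurePreserving.ae
          (p := fun t => t ∈ (induced τ W ψ (induced τ B φ P)).cell a ↔ t ∈ P.cell a)
          ((dist_eq_zero_iff.1 hψ a).mono fun t ht => iff_of_eq ht)
    filter_upwards [hae] with t ht x hx
    refine mem_iInter.2 fun l => eq_of_mem_cell (hx l) ((ht l _).1 ?_)
    refine mem_cell_induced.2 ⟨_, rfl, fun w => ?_⟩
    have := hx.induced hφ (l + w)
    rwa [map_add, ← add_assoc] at this
  intro x hx y hy hxy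
  refine funext fun l => ?_
  rw [show x l = _ from mem_iInter.1 (hsub hx) l, show y l = _ from mem_iInter.1 (hsub hy) l, hxy]

end MPartition

end Quasisturmian

end

/-! ### The dense `Gδ` set -/

open Quasisturmian.MPartition in
theorem theorem6p1 {D K : ℕ} (hD : 1 ≤ D) (hK : 1 ≤ K)
    {A : Type*} [Fintype A] [TopologicalSpace A] [DiscreteTopology A]
    [MeasurableSpace A] [MeasurableSingletonClass A]
    (τ : ZLat D →+ UnitAddTorus (Fin K)) (hτ : Function.Injective τ) (hτd : DenseRange τ)
    (Φ : Config D A → Config D A) (hΦ : IsCellularAutomaton Φ) :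
    ∃ I : Set (MPartition K A), IsGδ I ∧ Dense I ∧
      (∀ (B : Finset (ZLat D)) (φ : (B → A) → A), IsLocalMap Φ B φ →
        MPartition.induced τ B φ '' I ⊆ I) ∧
      ∀ P ∈ I,
        ((∃ y, ∀ᵐ x ∂P.qsMeasure τ, Φ x = y) ∨
          ∃ S : Set (Config D A), (∀ᵐ x ∂P.qsMeasure τ, x ∈ S) ∧ InjOn Φ S) ∧
        (P.IsOpenPartition →
          (∃ y, ∀ x ∈ P.qsShift τ, Φ x = y) ∨ InjOn Φ (P.qsShift τ)) := by
  classical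
  obtain ⟨B, φ, hφ⟩ := hΦ.exists_isLocalMap
  -- The argument works for any finite window. This one contains `-b` for each `b ∈ B`, so that when
  -- `Φ` is a shift it can be undone within the window.
  let W : Finset (ZLat D) := insert 0 (B.image Neg.neg)
  let G : MPartition K A → MPartition K A := induced τ B φ
  have hGδ : ∀ n, IsGδ (G^[n] ⁻¹' {P | P.IsGood τ B φ W}) := fun n =>
    (isGδ_setOf_isGood τ B φ W).preimage ((continuous_induced τ B φ).iterate n)
  have hdense : ∀ n, Dense (G^[n] ⁻¹' {P | P.IsGood τ B φ W}) := by
    intro n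
    -- A single local map of `Φ^[n]` replaces the iterate `G^[n]`; the two images of `P` are at
    -- distance zero, which a `Gδ` set does not notice.
    obtain ⟨Bn, φn, hφn⟩ := (hΦ.iterate n).exists_isLocalMap
    refine (dense_setOf_isTrivial_or_isSimple_induced hK hτ Bn φn).mono fun P hP => ?_
    refine mem_of_isGδ_of_dist_eq_zero (isGδ_setOf_isGood τ B φ W) (x := induced τ Bn φn P) ?_
      (hP.imp_right fun h => ⟨h.1, Or.inl h.2⟩)
    refine dist_eq_zero_of_ae_isTraj (τ := τ) ?_
    filter_upwards [P.ae_exists_isTraj τ] with t ⟨x, hx⟩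
    exact ⟨_, hx.induced hφn, hx.iterate_induced hφ n⟩
  have hI : IsGδ (⋂ n, G^[n] ⁻¹' {P | P.IsGood τ B φ W}) := IsGδ.iInter hGδ
  refine ⟨⋂ n, G^[n] ⁻¹' {P | P.IsGood τ B φ W}, hI, dense_iInter_of_Gδ hGδ hdense, ?_, ?_⟩
  · rintro B' φ' hφ' _ ⟨P, hP, rfl⟩
    refine mem_of_isGδ_of_dist_eq_zero hI (x := G P) ?_ ?_
    · refine dist_eq_zero_of_ae_isTraj (τ := τ) ?_
      filter_upwards [P.ae_exists_isTraj τ] with t ⟨x, hx⟩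
      exact ⟨_, hx.induced hφ, hx.induced hφ'⟩
    · refine mem_iInter.2 fun n => ?_
      rw [mem_preimage, ← Function.iterate_succ_apply]
      exact mem_iInter.1 hP (n + 1)
  · intro P hP
    refine ⟨?_, fun hopen => ?_⟩
    · rcases mem_iInter.1 hP 1 with hT | ⟨hS, -⟩
      · exact Or.inl (ae_qsMeasure_const hφ hT)
      · exact Or.inr (ae_qsMeasure_injOn hτd hφ hS)
    · rcases mem_iInter.1 hP 0 with hT | ⟨-, hN | hR⟩
      · obtain ⟨y, hy⟩ := hopen.qsShift_subset_singleton (τ := τ) hT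
        exact Or.inl ⟨Φ y, fun x hx => congrArg Φ (hy hx)⟩
      · exact absurd hN hopen.not_isNowhereOpen
      · exact Or.inr (hopen.injOn_qsShift hΦ.continuous hφ hR)
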